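/- Call a set $Z\subseteq\mathbb{N}$ a $\Pi^0_2$ set if there is a computable relation $R\subseteq\mathbb{N}^3$ such that, for all $i$, $i\in Z$ if and only if for every $x$ there is a $y$ with $R(x,y,i)$. A computable ring is a ring whose underlying set is a computable set $A\subseteq\mathbb{N}$ and whose addition and multiplication are computable functions from $A\times A$ to $A$; a computable UFD is a computable ring that is a unique factorization domain. **Theorem 1.5.** Let $Q\subseteq\mathbb{N}$ be a $\Pi^0_2$ set, and let $p_0,p_1,p_2,\dots$ list the usual prime numbers in increasing order. Then there exists a computable UFD $A$ such that $\mathbb{Z}$ is a subring of $A$ (that is, there is an injective ring homomorphism $\mathbb{Z}\to A$, by which integers are regarded as elements of $A$) and, for every $i\in\mathbb{N}$, $p_i$ is a prime element of $A$ if and only if $i\in Q$. -/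

import Mathlib

/-- `Z ⊆ ℕ` is a `Π⁰₂` set: `i ∈ Z ↔ ∀ x, ∃ y, R x y i` for some computable ternary relation `R`
on the natural numbers. -/
def IsPi02 (Z : Set ℕ) : Prop :=
  ∃ R : ℕ → ℕ → ℕ → Prop,
    ComputablePred (fun t : ℕ × ℕ × ℕ => R t.1 t.2.1 t.2.2) ∧
      ∀ i, i ∈ Z ↔ ∀ x, ∃ y, R x y i

/-- A computable ring: a ring whose underlying set is a computable set `A ⊆ ℕ` and whose addition
and multiplication are computable functions `A × A → A`. As `A` is a computable set, a function
`A × A → A` is computable exactly when it is the restriction of a total computable function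
`ℕ × ℕ → ℕ`. -/
structure IsComputableRing (A : Set ℕ) [Ring A] : Prop where
  carrier : ComputablePred (fun n : ℕ => n ∈ A)
  add : ∃ f : ℕ → ℕ → ℕ, Computable₂ f ∧ ∀ a b : A, f (a : ℕ) (b : ℕ) = ((a + b : A) : ℕ)
  mul : ∃ f : ℕ → ℕ → ℕ, Computable₂ f ∧ ∀ a b : A, f (a : ℕ) (b : ℕ) = ((a * b : A) : ℕ)

/-!
For each prime `q` take variables `x (q, 0)`, `x (q, 1)`, …, the next one coming into existence when
one more of the conditions `∃ y, R x y i` required for `i ∈ Q`, where `i` is the index of `q`, has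
been seen to hold. The current last variable divides `q`, so that `q = x * (q / x)` is a proper
factorization. When a new variable appears, the old one is made a unit and the new one is made a
divisor of `q` in its place. If `i ∉ Q`, there is a last variable, and `q` is reducible in the limit
ring. If `i ∈ Q`, all variables for `q` end up as units, and `q` is a prime element.

The limit ring is described inside the ring `B` of Laurent polynomials over `ℤ` in all existing
variables. For each `q` that has a last variable `x`, the Gauss valuation `laurentVal` gives `q` and
`x` the value of a uniformizer, and the limit ring is the subring `commonIntegers` of the elements
that are integral for all these valuations. As `B` is a UFD in which the prime numbers are prime,
and each valuation has a unit of `B` as uniformizer with value `1` for the others, the subring is a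
UFD (`IsUniformized.uniqueFactorizationMonoid`). A prime number stays prime in it if it has value
`1` for all valuations, that is, if it has no last variable.

For computability, the ring is generated by an enumerable family of monomial terms
(`commonIntegers_le`). Codes for its elements are formal differences of sums of products of
generators, for which addition and multiplication are formal, and equality is decided by comparing
the coefficients of each monomial (`MonomialFamily.exists_isComputableRing`). Taking the least code
of each element gives a ring with a computable underlying set
(`exists_isComputableRing_of_primrec`).
-/

/-! ### Gauss valuations on group rings -/

section GaussValuation

variable {K G Γ₀ : Type*} [CommRing K] [AddCommGroup G]
  [LinearOrderedCommGroupWithZero Γ₀]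

open AddMonoidAlgebra

/-- The Gauss norm on the group ring `K[G]` for which the monomial `m` has weight `χ m`: the largest
value `v (f m) * χ m` over the coefficients of `f`. It underlies `gaussValuation`. -/
def gaussNormAux (v : Valuation K Γ₀) (χ : Multiplicative G →* Γ₀) (f : K[G]) : Γ₀ :=
  f.coeff.support.sup fun m => v (f.coeff m) * χ (.ofAdd m)

theorem gaussNormAux_le_iff (v : Valuation K Γ₀) (χ : Multiplicative G →* Γ₀) (f : K[G]) (γ : Γ₀) :
    gaussNormAux v χ f ≤ γ ↔ ∀ m, v (f.coeff m) * χ (.ofAdd m) ≤ γ := by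
  rw [gaussNormAux, Finset.sup_le_iff]
  refine ⟨fun h m => ?_, fun h m _ => h m⟩
  by_cases hm : m ∈ f.coeff.support
  · exact h m hm
  · simp [Finsupp.notMem_support_iff.1 hm]

theorem exists_gaussNormAux_eq (v : Valuation K Γ₀) (χ : Multiplicative G →* Γ₀) (f : K[G]) :
    ∃ m, gaussNormAux v χ f = v (f.coeff m) * χ (.ofAdd m) := by
  by_cases hf : f.coeff.support.Nonempty
  · obtain ⟨m, _, hm⟩ := Finset.exists_mem_eq_sup _ hf
      fun m => v (f.coeff m) * χ (.ofAdd m)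
    exact ⟨m, hm⟩
  · have : f.coeff = 0 := by simpa using hf
    exact ⟨0, by simpa [gaussNormAux, this] using le_antisymm bot_le zero_le⟩

/-- Gauss's lemma. Among the pairs of terms of `f` and `g` of maximal value there is one whose
exponents have a sum that no other such pair attains, because `G` has unique sums; its product
dominates the corresponding coefficient of `f * g`. -/
theorem gaussNormAux_mul [UniqueSums G] (v : Valuation K Γ₀) (χ : Multiplicative G →* Γ₀)
    (f g : K[G]) :
    gaussNormAux v χ (f * g) = gaussNormAux v χ f * gaussNormAux v χ g := by
  classical
  have hχ : ∀ m, 0 < χ m := fun m => zero_lt_iff.2 ((Group.isUnit m).map χ).ne_zero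
  have le_f := (gaussNormAux_le_iff v χ f _).1 le_rfl
  have le_g := (gaussNormAux_le_iff v χ g _).1 le_rfl
  have coeff_eq : ∀ m, (f * g).coeff m = ∑ ab ∈ f.coeff.support ×ˢ g.coeff.support,
      if ab.1 + ab.2 = m then f.coeff ab.1 * g.coeff ab.2 else 0 := fun m => by
    rw [coeff_mul, Finsupp.sum, Finset.sum_product]; rfl
  have term_le : ∀ a b, v (f.coeff a * g.coeff b) * χ (.ofAdd (a + b)) ≤
      gaussNormAux v χ f * gaussNormAux v χ g := fun a b => by
    rw [map_mul, ofAdd_add, map_mul, mul_mul_mul_comm]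
    exact mul_le_mul' (le_f a) (le_g b)
  apply le_antisymm
  · rw [gaussNormAux_le_iff]
    intro m
    rw [← le_mul_inv_iff₀ (hχ _), coeff_eq]
    refine v.map_sum_le fun ab _ => ?_
    split_ifs with h
    · rw [le_mul_inv_iff₀ (hχ _), ← h]; exact term_le _ _
    · simp
  · rcases eq_or_ne (gaussNormAux v χ f) 0 with hf | hf
    · simp [hf]
    rcases eq_or_ne (gaussNormAux v χ g) 0 with hg | hg
    · simp [hg]
    obtain ⟨mf, hmf⟩ := exists_gaussNormAux_eq v χ f
    obtain ⟨mg, hmg⟩ := exists_gaussNormAux_eq v χ g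
    obtain ⟨a, ha, b, hb, hab⟩ := UniqueSums.uniqueAdd_of_nonempty
      (A := {m ∈ f.coeff.support | v (f.coeff m) * χ (.ofAdd m) = gaussNormAux v χ f})
      (B := {m ∈ g.coeff.support | v (g.coeff m) * χ (.ofAdd m) = gaussNormAux v χ g})
      ⟨mf, by
        rw [Finset.mem_filter, Finsupp.mem_support_iff]
        exact ⟨fun h => hf (by simp [hmf, h]), hmf.symm⟩⟩
      ⟨mg, by
        rw [Finset.mem_filter, Finsupp.mem_support_iff]
        exact ⟨fun h => hg (by simp [hmg, h]), hmg.symm⟩⟩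
    rw [Finset.mem_filter] at ha hb
    have main : v (f.coeff a * g.coeff b) * χ (.ofAdd (a + b)) =
        gaussNormAux v χ f * gaussNormAux v χ g := by
      rw [map_mul, ofAdd_add, map_mul, mul_mul_mul_comm, ha.2, hb.2]
    have hv : v ((f * g).coeff (a + b)) = v (f.coeff a * g.coeff b) := by
      rw [coeff_eq, ← Finset.add_sum_erase _ _ (Finset.mk_mem_product ha.1 hb.1), if_pos rfl]
      apply Valuation.map_add_eq_of_lt_left
      refine v.map_sum_lt ?_ fun xy hxy => ?_
      · intro h
        exact mul_ne_zero hf hg (by rw [← main, h, zero_mul])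
      rw [Finset.mem_erase, Finset.mem_product] at hxy
      split_ifs with h
      · rw [← mul_lt_mul_iff_left₀ (hχ (.ofAdd (a + b))), main]
        refine lt_of_le_of_ne (h ▸ term_le _ _) fun heq => hxy.1 ?_
        rw [← h, map_mul, ofAdd_add, map_mul, mul_mul_mul_comm] at heq
        have hx : v (f.coeff xy.1) * χ (.ofAdd xy.1) = gaussNormAux v χ f := by
          refine le_antisymm (le_f _) (le_of_not_gt fun hlt => heq.not_lt ?_)
          exact (mul_le_mul_right (le_g _) _).trans_lt
            (mul_lt_mul_of_pos_right hlt (zero_lt_iff.2 hg))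
        have hy : v (g.coeff xy.2) * χ (.ofAdd xy.2) = gaussNormAux v χ g := by
          rw [hx] at heq
          exact mul_left_cancel₀ hf heq
        obtain ⟨h1, h2⟩ := hab (Finset.mem_filter.2 ⟨hxy.2.1, hx⟩)
          (Finset.mem_filter.2 ⟨hxy.2.2, hy⟩) h
        exact Prod.ext h1 h2
      · rw [map_zero, zero_lt_iff]
        intro h
        exact mul_ne_zero hf hg (by rw [← main, h, zero_mul])
    rw [← main, ← hv]
    exact (gaussNormAux_le_iff v χ _ _).1 le_rfl _

/-- The Gauss valuation on `K[G]` extending the valuation `v` of `K` and giving the monomial `m` the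
value `χ m`. -/
def gaussValuation [UniqueSums G] (v : Valuation K Γ₀) (χ : Multiplicative G →* Γ₀) :
    Valuation K[G] Γ₀ where
  toFun := gaussNormAux v χ
  map_zero' := by simpa [gaussNormAux] using le_antisymm bot_le zero_le
  map_one' := by
    apply le_antisymm
    · classical
      rw [gaussNormAux_le_iff]
      intro m
      rw [one_def, coeff_single, Finsupp.single_apply]
      split_ifs with h
      · simp [← h]
      · simp
    · simpa [one_def] using (gaussNormAux_le_iff v χ (1 : K[G]) _).1 le_rfl 0
  map_mul' := gaussNormAux_mul v χ
  map_add_le_max' f g := by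
    rw [gaussNormAux_le_iff]
    intro m
    have hf := (gaussNormAux_le_iff v χ f _).1 le_rfl m
    have hg := (gaussNormAux_le_iff v χ g _).1 le_rfl m
    rw [coeff_add, Finsupp.add_apply]
    calc _ ≤ max (v (f.coeff m)) (v (g.coeff m)) * χ (.ofAdd m) :=
          mul_le_mul_left (v.map_add _ _) _
      _ = max (v (f.coeff m) * χ (.ofAdd m)) (v (g.coeff m) * χ (.ofAdd m)) :=
          (max_mul_mul_right _ _ _).symm
      _ ≤ _ := max_le_max hf hg

variable [UniqueSums G]

theorem gaussValuation_le_iff {v : Valuation K Γ₀} {χ : Multiplicative G →* Γ₀} {f : K[G]}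
    {γ : Γ₀} :
    gaussValuation v χ f ≤ γ ↔ ∀ m, v (f.coeff m) * χ (.ofAdd m) ≤ γ :=
  gaussNormAux_le_iff v χ f γ

theorem gaussValuation_single (v : Valuation K Γ₀) (χ : Multiplicative G →* Γ₀) (m : G) (c : K) :
    gaussValuation v χ (single m c) = v c * χ (.ofAdd m) := by
  apply le_antisymm
  · classical
    rw [gaussValuation_le_iff]
    intro m'
    rw [coeff_single, Finsupp.single_apply]
    split_ifs with h
    · rw [h]
    · simp
  · simpa using (gaussValuation_le_iff (v := v) (χ := χ) (f := single m c)).1 le_rfl m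

end GaussValuation

/-! ### Subrings cut out by discrete valuations -/

section ValuationIntersection

open WithZero

variable {B ι : Type*} [CommRing B]

/-- The elements of `B` that are integral for every valuation of the family `w`. -/
def commonIntegers (w : ι → Valuation B ℤᵐ⁰) : Subring B := ⨅ i, (w i).integer

theorem mem_commonIntegers {w : ι → Valuation B ℤᵐ⁰} {b : B} :
    b ∈ commonIntegers w ↔ ∀ i, w i b ≤ 1 := by
  simp [commonIntegers, Subring.mem_iInf, Valuation.mem_integer_iff]

/-- A family of discrete valuations `w i` on `B`, nonzero on nonzero elements, such that every
nonzero element has value `1` for almost all of them, together with units `x i` of `B` that are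
uniformizers: `x i` has value `exp (-1)` for `w i` and value `1` for the other valuations. -/
structure IsUniformized (w : ι → Valuation B ℤᵐ⁰) (x : ι → Bˣ) : Prop where
  self (i : ι) : w i (x i) = exp (-1)
  of_ne {i j : ι} : i ≠ j → w j (x i) = 1
  ne_zero {b : B} (i : ι) : b ≠ 0 → w i b ≠ 0
  finite {b : B} : b ≠ 0 → {i | w i b ≠ 1}.Finite

namespace IsUniformized

variable {w : ι → Valuation B ℤᵐ⁰} {x : ι → Bˣ} (h : IsUniformized w x)

include h

theorem mem (i : ι) : (x i : B) ∈ commonIntegers w := by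
  rw [mem_commonIntegers]
  intro j
  rcases eq_or_ne i j with rfl | hij
  · rw [h.self, ← exp_zero, exp_le_exp]; norm_num
  · rw [h.of_ne hij]

theorem apply_prod (n : ι →₀ ℤ) (j : ι) :
    w j ((n.prod fun i k => x i ^ k : Bˣ) : B) = exp (-n j) := by
  classical
  have key : Units.map (w j : B →* ℤᵐ⁰) (n.prod fun i k => x i ^ k) =
      Units.mk0 (exp (-n j)) exp_ne_zero := by
    rw [Finsupp.prod, map_prod]
    have h1 : ∀ i ∈ n.support, Units.map (w j : B →* ℤᵐ⁰) (x i ^ n i) =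
        if i = j then Units.mk0 (exp (-n j)) exp_ne_zero else 1 := by
      intro i _
      rw [map_zpow]
      split_ifs with hij
      · subst hij
        ext1
        simp [h.self i]
      · have : Units.map (w j : B →* ℤᵐ⁰) (x i) = 1 := Units.ext (h.of_ne hij)
        rw [this, one_zpow]
    rw [Finset.prod_congr rfl h1, Finset.prod_ite_eq']
    split_ifs with hj
    · rfl
    · rw [Finsupp.notMem_support_iff] at hj
      ext1
      simp [hj]
  simpa using congrArg (fun u : (ℤᵐ⁰)ˣ => (u : ℤᵐ⁰)) key

theorem exists_exponents {b : B} (hb : b ≠ 0) : ∃ n : ι →₀ ℤ, ∀ i, w i b = exp (-n i) := by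
  refine ⟨Finsupp.ofSupportFinite (fun i => -log (w i b)) ((h.finite hb).subset ?_), fun i => ?_⟩
  · intro i hi h1
    simp [h1] at hi
  · simp only [Finsupp.ofSupportFinite_coe, neg_neg]
    exact (exp_log (h.ne_zero i hb)).symm

/-- Every nonzero element of `B` becomes a unit for all the valuations after multiplication by a
unit. -/
theorem exists_unit_mul {b : B} (hb : b ≠ 0) : ∃ u : Bˣ, ∀ i, w i (u * b) = 1 := by
  obtain ⟨n, hn⟩ := h.exists_exponents hb
  refine ⟨(-n).prod fun i k => x i ^ k, fun i => ?_⟩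
  rw [map_mul, h.apply_prod, hn, ← exp_add]
  simp

omit h in
theorem dvd_of_coe_dvd {a b : commonIntegers w} (ha : ∀ i, w i (a : B) = 1)
    (hab : (a : B) ∣ b) : a ∣ b := by
  obtain ⟨c, hc⟩ := hab
  refine ⟨⟨c, mem_commonIntegers.2 fun i => ?_⟩, Subtype.ext hc⟩
  have := mem_commonIntegers.1 b.2 i
  rwa [hc, map_mul, ha, one_mul] at this

omit h in
theorem isUnit_of_coe {a : commonIntegers w} (ha : ∀ i, w i (a : B) = 1)
    (hu : IsUnit (a : B)) : IsUnit a :=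
  isUnit_of_dvd_one (dvd_of_coe_dvd ha (by simpa using hu.dvd))

omit h in
theorem prime_of_coe {a : commonIntegers w} (ha : ∀ i, w i (a : B) = 1)
    (hp : Prime (a : B)) : Prime a := by
  refine ⟨fun h0 => hp.ne_zero (by simp [h0]), fun hu => hp.not_isUnit
    (hu.map (commonIntegers w).subtype), fun b c hbc => ?_⟩
  refine (hp.dvd_or_dvd ?_).imp (dvd_of_coe_dvd ha) (dvd_of_coe_dvd ha)
  simpa using map_dvd (commonIntegers w).subtype hbc

theorem uniformizer_dvd_iff (i : ι) (a : commonIntegers w) :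
    (⟨x i, h.mem i⟩ : commonIntegers w) ∣ a ↔ w i (a : B) < 1 := by
  have h1 : w i (x i : B) < 1 := by rw [h.self, ← exp_zero, exp_lt_exp]; norm_num
  constructor
  · rintro ⟨c, rfl⟩
    simp only [Subring.coe_mul, map_mul]
    exact mul_lt_one_of_lt_of_le h1 (mem_commonIntegers.1 c.2 i)
  · intro ha
    have hinv : ∀ j, w j (((x i)⁻¹ : Bˣ) : B) = (w j (x i : B))⁻¹ := fun j => by
      refine eq_inv_of_mul_eq_one_left ?_
      rw [← map_mul, Units.inv_mul, map_one]
    refine ⟨⟨((x i)⁻¹ : Bˣ) * a, mem_commonIntegers.2 fun j => ?_⟩, Subtype.ext ?_⟩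
    · rw [map_mul, hinv]
      rcases eq_or_ne i j with rfl | hij
      · rcases eq_or_ne (w i (a : B)) 0 with h0 | h0
        · simp [h0]
        · rw [← exp_log h0, ← exp_zero, exp_lt_exp] at ha
          rw [← exp_log h0, h.self, ← exp_neg, ← exp_add, ← exp_zero, exp_le_exp]
          lia
      · rw [h.of_ne hij]
        simpa using mem_commonIntegers.1 a.2 j
    · simp

theorem not_isUnit_uniformizer (i : ι) : ¬ IsUnit (⟨x i, h.mem i⟩ : commonIntegers w) := by
  rw [isUnit_iff_dvd_one, h.uniformizer_dvd_iff]
  simp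

theorem prime_uniformizer [Nontrivial B] (i : ι) :
    Prime (⟨x i, h.mem i⟩ : commonIntegers w) := by
  refine ⟨fun h0 => (x i).ne_zero (congrArg Subtype.val h0), h.not_isUnit_uniformizer i,
    fun a b hab => ?_⟩
  simp only [h.uniformizer_dvd_iff] at hab ⊢
  by_contra! hcon
  have ha := le_antisymm (mem_commonIntegers.1 a.2 i) hcon.1
  have hb := le_antisymm (mem_commonIntegers.1 b.2 i) hcon.2
  simp [ha, hb] at hab

/-- If `B` is a UFD, so is the subring of common integers: dividing an element by powers of the
uniformizers, which are prime in the subring, leaves an element of value `1` everywhere, and the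
prime factors in `B` of the latter can be normalized to have value `1` everywhere too. -/
theorem uniqueFactorizationMonoid [IsDomain B] [UniqueFactorizationMonoid B] :
    UniqueFactorizationMonoid (commonIntegers w) := by
  classical
  let F : commonIntegers w → Prop := fun a =>
    ∃ f : Multiset (commonIntegers w), (∀ b ∈ f, Prime b) ∧ Associated f.prod a
  have F_mul : ∀ a b, F a → F b → F (a * b) := by
    rintro a b ⟨f, hf, hfa⟩ ⟨g, hg, hgb⟩
    refine ⟨f + g, fun c hc => (Multiset.mem_add.1 hc).elim (hf c) (hg c), ?_⟩
    rw [Multiset.prod_add]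
    exact hfa.mul_mul hgb
  have F_prime : ∀ a, Prime a → F a := fun a ha => ⟨{a}, by simpa using ha, by simp⟩
  have F_unit : ∀ a, IsUnit a → F a := fun a ha =>
    ⟨0, by simp, by simpa [associated_one_iff_isUnit] using (associated_one_iff_isUnit.2 ha).symm⟩
  -- elements with value `1` everywhere, by induction on a factorization in `B`
  have F_normal : ∀ b : B, b ≠ 0 → ∀ a : commonIntegers w, (∀ i, w i (a : B) = 1) →
      ∀ u : Bˣ, (a : B) = u * b → F a := by
    intro b
    induction b using UniqueFactorizationMonoid.induction_on_prime with
    | h₁ => exact fun h0 => absurd rfl h0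
    | h₂ b hb =>
      intro _ a ha u hab
      exact F_unit a (isUnit_of_coe ha (hab ▸ u.isUnit.mul hb))
    | h₃ b p hb hp ih =>
      intro _ a ha u hab
      obtain ⟨v, hv⟩ := h.exists_unit_mul hp.ne_zero
      have hp' : ∀ i, w i (↑(u * v⁻¹) * b) = 1 := fun i => by
        have := ha i
        rw [hab, show (u : B) * (p * b) = (v * p) * (↑(u * v⁻¹) * b) by
          rw [Units.val_mul]
          linear_combination (-(u : B) * p * b) * v.mul_inv, map_mul, hv, one_mul] at this
        exact this
      have := F_mul ⟨v * p, mem_commonIntegers.2 fun i => (hv i).le⟩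
        ⟨↑(u * v⁻¹) * b, mem_commonIntegers.2 fun i => (hp' i).le⟩
        (F_prime _ (prime_of_coe hv ((associated_unit_mul_left p _ v.isUnit).symm.prime hp)))
        (ih hb _ hp' _ rfl)
      convert this using 1
      refine Subtype.ext (hab.trans ?_)
      simp only [Subring.coe_mul, Units.val_mul]
      linear_combination (-(u : B) * p * b) * v.mul_inv
  refine UniqueFactorizationMonoid.of_exists_prime_factors fun a ha => ?_
  have ha' : (a : B) ≠ 0 := fun h0 => ha (Subtype.ext h0)
  obtain ⟨n, hn⟩ := h.exists_exponents ha'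
  have hn0 : ∀ i, 0 ≤ n i := fun i => by
    have := mem_commonIntegers.1 a.2 i
    rw [hn, ← exp_zero, exp_le_exp] at this
    lia
  have hprod : ((n.prod fun i k => x i ^ k : Bˣ) : B) =
      ((∏ i ∈ n.support, ⟨x i, h.mem i⟩ ^ (n i).toNat : commonIntegers w) : B) := by
    rw [Finsupp.prod, Units.coe_prod, SubmonoidClass.coe_finsetProd]
    refine Finset.prod_congr rfl fun i _ => ?_
    conv_lhs => rw [← Int.toNat_of_nonneg (hn0 i), zpow_natCast]
    rfl
  have hq : ∀ i, w i (((n.prod fun i k => x i ^ k)⁻¹ : Bˣ) * (a : B)) = 1 := fun i => by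
    have h1 := hn i
    rw [← h.apply_prod, show (a : B) = (n.prod fun i k => x i ^ k : Bˣ) *
      (((n.prod fun i k => x i ^ k)⁻¹ : Bˣ) * (a : B)) by simp, map_mul] at h1
    exact mul_left_cancel₀ (h.ne_zero i (Units.ne_zero _)) (by simpa using h1)
  have := F_mul (∏ i ∈ n.support, ⟨x i, h.mem i⟩ ^ (n i).toNat)
    ⟨((n.prod fun i k => x i ^ k)⁻¹ : Bˣ) * (a : B), mem_commonIntegers.2 fun i => (hq i).le⟩
    (Finset.prod_induction _ F F_mul (F_unit 1 isUnit_one) fun i _ => by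
      induction (n i).toNat with
      | zero => exact F_unit _ (by simp)
      | succ k ih => rw [pow_succ]; exact F_mul _ _ ih (F_prime _ (h.prime_uniformizer i)))
    (F_normal a ha' _ hq _ rfl)
  refine (congrArg F (Subtype.ext ?_)).mp this
  rw [Subring.coe_mul, ← hprod]
  simp

end IsUniformized

end ValuationIntersection

/-! ### Laurent polynomials and their valuations -/

section Laurent

open AddMonoidAlgebra WithZero

/-- Laurent polynomials over `ℤ` in the variables `X`. -/
abbrev MvLaurent (X : Type*) := AddMonoidAlgebra ℤ (X →₀ ℤ)

namespace MvLaurent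

variable {X : Type*}

/-- The Laurent monomial with exponent vector `m`, as a unit. -/
noncomputable def monomialUnit (m : X →₀ ℤ) : (MvLaurent X)ˣ where
  val := single m 1
  inv := single (-m) 1
  val_inv := by simp [single_mul_single, one_def]
  inv_val := by simp [single_mul_single, one_def]

@[simp]
theorem coe_monomialUnit (m : X →₀ ℤ) : (monomialUnit m : MvLaurent X) = single m 1 := rfl

/-- The inclusion of polynomials into Laurent polynomials. -/
noncomputable def ofMvPolynomial : MvPolynomial X ℤ →+* MvLaurent X :=
  mapDomainRingHom ℤ (Finsupp.mapRange.addMonoidHom (Nat.castAddMonoidHom ℤ))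

theorem ofMvPolynomial_monomial (s : X →₀ ℕ) (c : ℤ) :
    ofMvPolynomial (MvPolynomial.monomial s c) =
      single (Finsupp.mapRange.addMonoidHom (Nat.castAddMonoidHom ℤ) s) c :=
  mapDomain_single

theorem ofMvPolynomial_injective :
    Function.Injective (ofMvPolynomial : MvPolynomial X ℤ → MvLaurent X) :=
  mapDomain_injective (Finsupp.mapRange_injective _ (by simp) Nat.cast_injective)

theorem isLocalizationMap_ofMvPolynomial :
    (MonoidHom.mrange (MvPolynomial.monomialOneHom ℤ X)).IsLocalizationMap
      (ofMvPolynomial : MvPolynomial X ℤ → MvLaurent X) where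
  map_units := by
    rintro ⟨_, s, rfl⟩
    exact ofMvPolynomial_monomial s.toAdd 1 ▸ (monomialUnit _).isUnit
  surj z := by
    induction z using AddMonoidAlgebra.induction_linear with
    | zero => exact ⟨(0, 1), by simp⟩
    | add f g hf hg =>
      obtain ⟨⟨a, s⟩, ha⟩ := hf
      obtain ⟨⟨b, t⟩, hb⟩ := hg
      refine ⟨(a * t + b * s, s * t), ?_⟩
      simp only [Submonoid.coe_mul, map_mul, map_add] at ha hb ⊢
      rw [← ha, ← hb]
      ring
    | single m c =>
      refine ⟨(MvPolynomial.monomial (m.mapRange Int.toNat rfl) c,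
        ⟨MvPolynomial.monomial ((-m).mapRange Int.toNat rfl) 1, .ofAdd _, rfl⟩), ?_⟩
      simp only [ofMvPolynomial_monomial, single_mul_single, mul_one]
      congr 1
      ext x
      simp
      lia
  exists_of_eq hxy := ⟨1, by rw [ofMvPolynomial_injective hxy]⟩

/-- `ofMvPolynomial` as the localization of the polynomial ring at the monomials. -/
noncomputable def localizationMap :
    (MonoidHom.mrange (MvPolynomial.monomialOneHom ℤ X)).LocalizationMap (MvLaurent X) where
  __ := (ofMvPolynomial : MvPolynomial X ℤ →+* MvLaurent X).toMonoidHom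
  isLocalizationMap := isLocalizationMap_ofMvPolynomial

instance : UniqueFactorizationMonoid (MvLaurent X) :=
  localizationMap.uniqueFactorizationMonoid

theorem prime_natCast {p : ℕ} (hp : p.Prime) : Prime (p : MvLaurent X) := by
  have hm := localizationMap.map_prime (MvPolynomial.prime_C_iff (σ := X).2
    (Nat.prime_iff_prime_int.1 hp))
  have he : (localizationMap (MvPolynomial.C (p : ℤ)) : MvLaurent X) = p := by
    change ofMvPolynomial (MvPolynomial.C (p : ℤ)) = _
    simp
  rw [he] at hm
  refine hm (by simp [natCast_def, hp.ne_zero]) fun hu => ?_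
  obtain ⟨f, hf⟩ := hu.dvd (a := 1)
  have := congrArg (fun g : MvLaurent X => g.coeff 0) hf
  simp only [natCast_def, coeff_single_zero_mul, one_def, coeff_single, Finsupp.single_eq_same]
    at this
  exact Nat.prime_iff_prime_int.1 hp |>.not_isUnit (isUnit_of_dvd_one ⟨_, this⟩)

end MvLaurent

variable {X ι : Type*} (p : ι → ℕ) [∀ i, Fact (p i).Prime] (ξ : ι → X)

/-- The weight `m ↦ exp (-m x)` on monomials, for which the variable `x` has value `exp (-1)` and
all other variables have value `1`. -/
noncomputable def expWeight (x : X) : Multiplicative (X →₀ ℤ) →* ℤᵐ⁰ where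
  toFun m := exp (-(m.toAdd x))
  map_one' := by simp
  map_mul' a b := by simp [-exp_neg, ← exp_add, add_comm]

/-- The valuation on Laurent polynomials for which both the prime `p i` and the variable `ξ i` have
value `exp (-1)`, while the other variables have value `1`. Both `ξ i` and `p i / ξ i` are integral
for it, but `1 / ξ i` is not. -/
noncomputable def laurentVal (i : ι) : Valuation (MvLaurent X) ℤᵐ⁰ :=
  gaussValuation (Int.padicValuation (p i)) (expWeight (ξ i))

theorem laurentVal_single (i : ι) (m : X →₀ ℤ) (c : ℤ) :
    laurentVal p ξ i (single m c) = Int.padicValuation (p i) c * exp (-m (ξ i)) :=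
  gaussValuation_single _ _ _ _

theorem isUniformized_laurentVal (hp : Function.Injective p) (hξ : Function.Injective ξ) :
    IsUniformized (laurentVal p ξ) fun i =>
      MvLaurent.monomialUnit (Finsupp.single (ξ i) 1) where
  self i := by simp [laurentVal_single]
  of_ne {i j} hij := by
    simp [laurentVal_single, hξ.ne hij]
  ne_zero {b} i hb h0 := by
    apply hb
    ext m
    have := (gaussValuation_le_iff.1 h0.le m)
    simpa [expWeight] using this
  finite {b} hb := by
    classical
    obtain ⟨m₀, hm₀⟩ : ∃ m, b.coeff m ≠ 0 := by
      by_contra! hcon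
      exact hb (by ext m; simpa using hcon m)
    refine (Set.Finite.union (Set.Finite.preimage hξ.injOn
      (b.coeff.support.biUnion Finsupp.support).finite_toSet) (Set.Finite.preimage hp.injOn
      (b.coeff m₀).natAbs.divisors.finite_toSet)).subset fun i hi => ?_
    by_contra hcon
    simp only [Set.mem_union, Set.mem_preimage, Finset.mem_coe, Finset.mem_biUnion, not_or,
      not_exists, not_and, Finsupp.mem_support_iff, not_not, Nat.mem_divisors, ne_eq,
      Int.natAbs_eq_zero] at hcon
    apply hi
    apply le_antisymm
    · refine gaussValuation_le_iff.2 fun m => ?_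
      by_cases hm : b.coeff m = 0
      · simp [hm]
      · simpa [expWeight, hcon.1 m hm] using Int.padicValuation_le_one _ _
    · refine le_trans (le_of_eq ?_) (gaussValuation_le_iff.1 le_rfl m₀)
      have : Int.padicValuation (p i) (b.coeff m₀) = 1 := by
        rw [Int.padicValuation_eq_one_iff, Int.natCast_dvd]
        exact fun hd => hm₀ (hcon.2 hd)
      simp [expWeight, this, hcon.1 m₀ hm₀]

end Laurent

/-! ### The ring of common integers of the Laurent valuations -/

section LaurentIntegers

open AddMonoidAlgebra WithZero

theorem Int.pow_dvd_of_padicValuation_le {p : ℕ} [Fact p.Prime] (n : ℕ) (c : ℤ)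
    (h : Int.padicValuation p c ≤ exp (-n : ℤ)) : (p : ℤ) ^ n ∣ c := by
  induction n generalizing c with
  | zero => simp
  | succ n ih =>
    have hlt : Int.padicValuation p c < 1 := h.trans_lt (by
      rw [← exp_zero, exp_lt_exp]; push_cast; lia)
    obtain ⟨d, rfl⟩ := Int.padicValuation_lt_one_iff.1 hlt
    rw [pow_succ']
    refine mul_dvd_mul_left _ (ih d ?_)
    rw [map_mul, Int.padicValuation_self] at h
    have h2 := mul_le_mul_right h (exp (1 : ℤ))
    rw [← mul_assoc, ← exp_add, ← exp_add] at h2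
    simpa [-exp_neg] using h2

variable {X ι : Type*} {p : ι → ℕ} [∀ i, Fact (p i).Prime] {ξ : ι → X}

theorem single_mem_commonIntegers {m : X →₀ ℤ} {c : ℤ} :
    single m c ∈ commonIntegers (laurentVal p ξ) ↔
      ∀ i, Int.padicValuation (p i) c * exp (-m (ξ i)) ≤ 1 := by
  simp only [mem_commonIntegers, laurentVal_single]

theorem single_coeff_mem_commonIntegers {f : MvLaurent X}
    (hf : f ∈ commonIntegers (laurentVal p ξ)) (m : X →₀ ℤ) :
    single m (f.coeff m) ∈ commonIntegers (laurentVal p ξ) := by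
  rw [single_mem_commonIntegers]
  exact fun i => gaussValuation_le_iff.1 (mem_commonIntegers.1 hf i) m

/-- The common integers of the valuations `laurentVal p ξ` are generated by the variables, the
inverses of the variables outside the range of `ξ`, and the quotients `p i / ξ i`. -/
theorem commonIntegers_le (hp : Function.Injective p) {S : Subring (MvLaurent X)}
    (hX : ∀ x, single (Finsupp.single x 1) 1 ∈ S)
    (hinv : ∀ x ∉ Set.range ξ, single (Finsupp.single x (-1)) 1 ∈ S)
    (hdiv : ∀ i, single (Finsupp.single (ξ i) (-1)) (p i : ℤ) ∈ S) :
    commonIntegers (laurentVal p ξ) ≤ S := by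
  have single_mem : ∀ (m : X →₀ ℤ) (c : ℤ),
      single m c ∈ commonIntegers (laurentVal p ξ) → single m c ∈ S := by
    intro m
    induction m using Finsupp.induction with
    | zero =>
      intro c _
      simpa [intCast_def] using intCast_mem S c
    | single_add x e m hx _ ih =>
      intro c hc
      rw [single_mem_commonIntegers] at hc
      rw [Finsupp.notMem_support_iff] at hx
      have hval : ∀ i, ξ i ≠ x → (Finsupp.single x e + m) (ξ i) = m (ξ i) := fun i hi => by
        simp [hi]
      by_cases hcase : e < 0 ∧ ∃ i, ξ i = x
      · obtain ⟨he, i, rfl⟩ := hcase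
        obtain ⟨n, rfl⟩ : ∃ n : ℕ, e = -n := ⟨e.natAbs, by lia⟩
        have hdvd : (p i : ℤ) ^ n ∣ c := by
          apply Int.pow_dvd_of_padicValuation_le
          have := mul_le_mul_left (hc i) (exp (-n : ℤ))
          rwa [mul_assoc, ← exp_add, one_mul, Finsupp.add_apply, Finsupp.single_eq_same, hx,
            show -(-(n : ℤ) + 0) + -n = 0 by ring, exp_zero, mul_one] at this
        obtain ⟨d, rfl⟩ := hdvd
        have hd : single m d ∈ S := ih d (single_mem_commonIntegers.2 fun j => by
          rcases eq_or_ne (ξ j) (ξ i) with hj | hj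
          · simpa [hj, hx] using Int.padicValuation_le_one _ _
          · have hji : p j ≠ p i := fun h => hj (congrArg ξ (hp h))
            have h1 : Int.padicValuation (p j) (p i : ℤ) = 1 := by
              rw [Int.padicValuation_eq_one_iff, Int.natCast_dvd_natCast,
                Nat.prime_dvd_prime_iff_eq Fact.out Fact.out]
              exact hji
            simpa only [map_mul, map_pow, h1, one_pow, one_mul, hval j hj] using hc j)
        have := S.mul_mem (S.pow_mem (hdiv i) n) hd
        rw [single_pow, single_mul_single] at this
        simpa using this
      · have hm : single m c ∈ S := ih c (single_mem_commonIntegers.2 fun j => by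
          rcases eq_or_ne (ξ j) x with hj | hj
          · simpa [hj, hx] using Int.padicValuation_le_one _ _
          · simpa only [hval j hj] using hc j)
        have hxe : single (Finsupp.single x e) (1 : ℤ) ∈ S := by
          obtain ⟨n, rfl | rfl⟩ := Int.eq_nat_or_neg e
          · simpa [single_pow] using S.pow_mem (hX x) n
          · rcases Nat.eq_zero_or_pos n with rfl | hn
            · simpa [one_def] using S.one_mem
            · have hxr : x ∉ Set.range ξ := fun hxr => hcase ⟨by lia, hxr⟩
              simpa [single_pow] using S.pow_mem (hinv x hxr) n
        have := S.mul_mem hxe hm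
        rwa [single_mul_single, one_mul] at this
  intro f hf
  rw [← sum_coeff_single f]
  exact sum_mem fun m _ => single_mem m _ (single_coeff_mem_commonIntegers hf m)

instance : CharZero (MvLaurent X) :=
  ⟨fun a b h => by simpa [natCast_def, single_right_inj] using h⟩

instance (S : Subring (MvLaurent X)) : CharZero S :=
  ⟨fun a b h => by simpa using congrArg S.subtype h⟩

theorem laurentVal_natCast {i : ι} {q : ℕ} (hq : q.Prime) (hne : p i ≠ q) :
    laurentVal p ξ i (q : MvLaurent X) = 1 := by
  rw [natCast_def, laurentVal_single]
  simp [Int.padicValuation_eq_one_iff, Int.natCast_dvd_natCast,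
    Nat.prime_dvd_prime_iff_eq Fact.out hq, hne]

/-- A prime number outside the family `p` has value `1` for all valuations, so it stays prime. -/
theorem prime_natCast_commonIntegers {q : ℕ} (hq : q.Prime) (hqp : q ∉ Set.range p) :
    Prime (q : commonIntegers (laurentVal p ξ)) := by
  refine IsUniformized.prime_of_coe (fun i => ?_) ?_
  · exact laurentVal_natCast hq fun h => hqp ⟨i, h⟩
  · exact MvLaurent.prime_natCast hq

/-- `p i` is the product of the nonunits `ξ i` and `p i / ξ i`. -/
theorem not_prime_natCast_commonIntegers (hp : Function.Injective p)
    (hξ : Function.Injective ξ) (i : ι) :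
    ¬ Prime (p i : commonIntegers (laurentVal p ξ)) := by
  intro hprime
  have h := isUniformized_laurentVal p ξ hp hξ
  have hy : single (Finsupp.single (ξ i) (-1)) (p i : ℤ) ∈ commonIntegers (laurentVal p ξ) := by
    rw [single_mem_commonIntegers]
    intro j
    rcases eq_or_ne i j with rfl | hij
    · simp
    · simpa [hξ.ne hij] using Int.padicValuation_le_one _ _
  have hfac : (p i : commonIntegers (laurentVal p ξ)) =
      ⟨MvLaurent.monomialUnit (Finsupp.single (ξ i) 1), h.mem i⟩ * ⟨_, hy⟩ := by
    refine Subtype.ext ?_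
    simp [single_mul_single, natCast_def]
  rcases hprime.irreducible.isUnit_or_isUnit hfac with hu | hu
  · exact h.not_isUnit_uniformizer i hu
  · have hu' := (hu.map (commonIntegers (laurentVal p ξ)).subtype)
    refine (MvLaurent.prime_natCast (X := X) (Fact.out : (p i).Prime)).not_isUnit ?_
    have := (MvLaurent.monomialUnit (Finsupp.single (ξ i) 1)).isUnit.mul hu'
    have h2 := congrArg (commonIntegers (laurentVal p ξ)).subtype hfac
    rw [map_mul, map_natCast] at h2
    exact h2 ▸ this

end LaurentIntegers

/-! ### Computable presentations -/

section ComputablePresentation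

open Encodable

/-- A commutative ring whose elements have codes, with primitive recursive equality, addition and
multiplication on codes, is isomorphic to a computable ring, whose elements are the least codes. -/
theorem exists_isComputableRing_of_primrec {α A : Type*} [Primcodable α] [Inhabited α] [CommRing A]
    (π : α → A) (hπ : Function.Surjective π)
    (heq : PrimrecRel fun a b => π a = π b)
    {add mul : α → α → α} (hadd : Primrec₂ add) (hmul : Primrec₂ mul)
    (π_add : ∀ a b, π (add a b) = π a + π b) (π_mul : ∀ a b, π (mul a b) = π a * π b) :
    ∃ (C : Set ℕ) (_ : CommRing C), IsComputableRing C ∧ Nonempty (C ≃+* A) := by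
  classical
  let D : ℕ → α := fun n => (decode n).getD default
  have hD : Primrec D := Primrec.option_getD.comp Primrec.decode (Primrec.const _)
  have D_encode : ∀ a, D (encode a) = a := fun a => by simp [D]
  let ρ : ℕ → A := fun n => π (D n)
  have hρ : ∀ a, ∃ n, ρ n = a := fun a => by
    obtain ⟨b, rfl⟩ := hπ a
    exact ⟨encode b, by simp [ρ, D_encode]⟩
  -- `can n` is the least number with the same value as `n`
  let can : ℕ → ℕ := fun n => Nat.find (⟨n, rfl⟩ : ∃ m, ρ m = ρ n)
  have ρ_can : ∀ n, ρ (can n) = ρ n := fun n => Nat.find_spec (⟨n, rfl⟩ : ∃ m, ρ m = ρ n)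
  have can_congr : ∀ m n, ρ m = ρ n → can m = can n := fun m n h => by
    simp only [can, h]
  have hcan : Computable can :=
    Computable.find (P := fun n m => ρ m = ρ n) (PrimrecPred.computablePred
      (heq.comp (hD.comp Primrec.snd) (hD.comp Primrec.fst))) fun n => ⟨n, rfl⟩
  let C : Set ℕ := {n | can n = n}
  have can_mem : ∀ n, can n ∈ C := fun n => can_congr _ _ (ρ_can n)
  have bij : Function.Bijective (fun n : C => ρ n) := by
    constructor
    · rintro ⟨a, ha⟩ ⟨b, hb⟩ hab
      exact Subtype.ext (ha.symm.trans ((can_congr _ _ hab).trans hb))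
    · intro a
      obtain ⟨n, rfl⟩ := hρ a
      exact ⟨⟨can n, can_mem n⟩, ρ_can n⟩
  let e : C ≃ A := Equiv.ofBijective _ bij
  let _ : CommRing C := e.commRing
  have e_add : ∀ a b : C, e (a + b) = e a + e b := e.ringEquiv.map_add
  have e_mul : ∀ a b : C, e (a * b) = e a * e b := e.ringEquiv.map_mul
  have op : ∀ g : α → α → α, Primrec₂ g →
      Computable₂ fun m n => can (encode (g (D m) (D n))) := fun g hg =>
    hcan.comp (Primrec.encode.comp (hg.comp (hD.comp Primrec.fst) (hD.comp Primrec.snd))).to_comp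
  refine ⟨C, inferInstance, ⟨?_, ⟨_, op add hadd, fun a b => ?_⟩, ⟨_, op mul hmul, fun a b => ?_⟩⟩,
    ⟨e.ringEquiv⟩⟩
  · exact Computable.computablePred (p := fun n => can n = n)
      ((Primrec.eq (α := ℕ)).decide.to_comp.comp hcan Computable.id)
  · refine congrArg Subtype.val (bij.1 (a₁ := ⟨_, can_mem _⟩) (a₂ := a + b) ?_)
    change ρ _ = e (a + b)
    rw [e_add, ρ_can]
    simp only [ρ, D_encode, π_add]
    rfl
  · refine congrArg Subtype.val (bij.1 (a₁ := ⟨_, can_mem _⟩) (a₂ := a * b) ?_)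
    change ρ _ = e (a * b)
    rw [e_mul, ρ_can]
    simp only [ρ, D_encode, π_mul]
    rfl

end ComputablePresentation

section Words

open AddMonoidAlgebra

theorem Primrec.list_sum : Primrec (List.sum : List ℕ → ℕ) :=
  (Primrec.list_foldr Primrec.id (Primrec.const 0)
    (Primrec.nat_add.comp (Primrec.fst.comp Primrec.snd)
      (Primrec.snd.comp Primrec.snd)).to₂).of_eq fun l => by simp [List.sum_eq_foldr]

theorem Primrec.list_prod : Primrec (List.prod : List ℕ → ℕ) :=
  (Primrec.list_foldr Primrec.id (Primrec.const 1)
    (Primrec.nat_mul.comp (Primrec.fst.comp Primrec.snd)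
      (Primrec.snd.comp Primrec.snd)).to₂).of_eq fun l => by simp [List.prod_eq_foldr]

/-- A primitive recursive sequence of monomial terms: the term of index `g` is
`coef g * X (var g) ^ (pos g - neg g)`. The exponent is given as a difference of natural numbers, so
that all data are natural numbers. -/
structure MonomialFamily where
  coef : ℕ → ℕ
  var : ℕ → ℕ
  pos : ℕ → ℕ
  neg : ℕ → ℕ
  coef_primrec : Primrec coef
  var_primrec : Primrec var
  pos_primrec : Primrec pos
  neg_primrec : Primrec neg

namespace MonomialFamily

variable (M : MonomialFamily)

/-- The exponent vector of the term of index `g`. -/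
noncomputable def expo (g : ℕ) : ℕ →₀ ℤ := Finsupp.single (M.var g) (M.pos g - M.neg g : ℤ)

/-- The term of index `g`, as a Laurent polynomial. -/
noncomputable def term (g : ℕ) : MvLaurent ℕ := single (M.expo g) (M.coef g : ℤ)

/-- The exponent vector of the product of the terms listed in `l`. -/
noncomputable def wordExpo (l : List ℕ) : ℕ →₀ ℤ := (l.map M.expo).sum

/-- The coefficient of the product of the terms listed in `l`. -/
def wordCoef (l : List ℕ) : ℕ := (l.map M.coef).prod

/-- The product of the terms listed in `l`. -/
noncomputable def wordVal (l : List ℕ) : MvLaurent ℕ := (l.map M.term).prod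

theorem wordVal_eq (l : List ℕ) : M.wordVal l = single (M.wordExpo l) (M.wordCoef l : ℤ) := by
  induction l with
  | nil => simp [wordVal, wordExpo, wordCoef, one_def]
  | cons g l ih =>
    simp only [wordVal, wordExpo, wordCoef, List.map_cons, List.prod_cons, List.sum_cons] at ih ⊢
    rw [ih, term, single_mul_single, Nat.cast_mul]

/-- The sum of `f g` over those `g` in `l` whose term involves the variable `x`. -/
def total (f : ℕ → ℕ) (l : List ℕ) (x : ℕ) : ℕ :=
  (l.map fun g => if M.var g = x then f g else 0).sum

theorem wordExpo_apply (l : List ℕ) (x : ℕ) :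
    M.wordExpo l x = (M.total M.pos l x : ℤ) - M.total M.neg l x := by
  induction l with
  | nil => simp [wordExpo, total]
  | cons g l ih =>
    simp only [wordExpo, total, List.map_cons, List.sum_cons] at ih ⊢
    rw [Finsupp.add_apply, ih, expo, Finsupp.single_apply]
    split_ifs <;> push_cast <;> ring

theorem total_eq_zero (f : ℕ → ℕ) {l : List ℕ} {x : ℕ} (h : x ∉ l.map M.var) :
    M.total f l x = 0 := by
  rw [total, List.sum_eq_zero_iff]
  intro n hn
  obtain ⟨g, hg, rfl⟩ := List.mem_map.1 hn
  exact if_neg fun hx => h (List.mem_map.2 ⟨g, hg, hx⟩)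

theorem wordExpo_eq_iff (l l' : List ℕ) : M.wordExpo l = M.wordExpo l' ↔
    ∀ x ∈ (l ++ l').map M.var, M.total M.pos l x + M.total M.neg l' x =
      M.total M.pos l' x + M.total M.neg l x := by
  constructor
  · intro h x _
    have := DFunLike.congr_fun h x
    rw [wordExpo_apply, wordExpo_apply] at this
    lia
  · intro h
    ext x
    rw [wordExpo_apply, wordExpo_apply]
    by_cases hx : x ∈ (l ++ l').map M.var
    · have := h x hx
      lia
    · rw [List.map_append, List.mem_append, not_or] at hx
      simp [M.total_eq_zero _ hx.1, M.total_eq_zero _ hx.2]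

theorem total_primrec {f : ℕ → ℕ} (hf : Primrec f) : Primrec₂ (M.total f) := by
  refine Primrec.list_sum.comp (Primrec.list_map Primrec.fst ?_)
  exact Primrec.ite (Primrec.eq.comp (M.var_primrec.comp Primrec.snd)
    (Primrec.snd.comp Primrec.fst)) (hf.comp Primrec.snd) (Primrec.const 0)

theorem wordCoef_primrec : Primrec M.wordCoef :=
  Primrec.list_prod.comp (Primrec.list_map Primrec.id (M.coef_primrec.comp Primrec.snd).to₂)

theorem wordExpo_eq_primrec : PrimrecRel fun l l' => M.wordExpo l = M.wordExpo l' := by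
  have hrel : PrimrecRel fun (x : ℕ) (t : List ℕ × List ℕ) =>
      M.total M.pos t.1 x + M.total M.neg t.2 x = M.total M.pos t.2 x + M.total M.neg t.1 x := by
    have h1 : Primrec fun y : ℕ × List ℕ × List ℕ => y.1 := Primrec.fst
    have h2 : Primrec fun y : ℕ × List ℕ × List ℕ => y.2.1 := Primrec.fst.comp Primrec.snd
    have h3 : Primrec fun y : ℕ × List ℕ × List ℕ => y.2.2 := Primrec.snd.comp Primrec.snd
    exact Primrec.eq.comp
      (Primrec.nat_add.comp ((M.total_primrec M.pos_primrec).comp h2 h1)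
        ((M.total_primrec M.neg_primrec).comp h3 h1))
      (Primrec.nat_add.comp ((M.total_primrec M.pos_primrec).comp h3 h1)
        ((M.total_primrec M.neg_primrec).comp h2 h1))
  have hlist : Primrec fun t : List ℕ × List ℕ => (t.1 ++ t.2).map M.var :=
    Primrec.list_map (Primrec.list_append.comp Primrec.fst Primrec.snd)
      (M.var_primrec.comp Primrec.snd).to₂
  exact ((hrel.forall_mem_list).comp hlist Primrec.id).of_eq fun t =>
    (M.wordExpo_eq_iff t.1 t.2).symm

/-- The sum of the products given by the words in `L`. -/
noncomputable def sumVal (L : List (List ℕ)) : MvLaurent ℕ := (L.map M.wordVal).sum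

open Classical in
/-- The sum of the coefficients of those words in `L` that have the same exponent vector as `l`. -/
noncomputable def sumCoef (L : List (List ℕ)) (l : List ℕ) : ℕ :=
  (L.map fun l' => if M.wordExpo l' = M.wordExpo l then M.wordCoef l' else 0).sum

theorem coeff_sumVal_wordExpo (L : List (List ℕ)) (l : List ℕ) :
    (M.sumVal L).coeff (M.wordExpo l) = M.sumCoef L l := by
  classical
  induction L with
  | nil => simp [sumVal, sumCoef]
  | cons l' L ih =>
    simp only [sumVal, sumCoef, List.map_cons, List.sum_cons] at ih ⊢
    rw [coeff_add, Finsupp.add_apply, ih, wordVal_eq, coeff_single, Finsupp.single_apply]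
    push_cast
    rfl

theorem coeff_sumVal_eq_zero {L : List (List ℕ)} {m : ℕ →₀ ℤ}
    (h : ∀ l ∈ L, M.wordExpo l ≠ m) : (M.sumVal L).coeff m = 0 := by
  induction L with
  | nil => simp [sumVal]
  | cons l' L ih =>
    simp only [sumVal, List.map_cons, List.sum_cons] at ih ⊢
    rw [coeff_add, Finsupp.add_apply, ih fun l hl => h l (List.mem_cons_of_mem _ hl), wordVal_eq,
      coeff_single, Finsupp.single_eq_of_ne (h l' List.mem_cons_self).symm, add_zero]

theorem sumVal_eq_iff (L L' : List (List ℕ)) : M.sumVal L = M.sumVal L' ↔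
    ∀ l ∈ L ++ L', M.sumCoef L l = M.sumCoef L' l := by
  constructor
  · intro h l _
    have := M.coeff_sumVal_wordExpo L l
    rw [h, coeff_sumVal_wordExpo] at this
    exact_mod_cast this.symm
  · intro h
    ext m
    by_cases hm : ∃ l ∈ L ++ L', M.wordExpo l = m
    · obtain ⟨l, hl, rfl⟩ := hm
      rw [coeff_sumVal_wordExpo, coeff_sumVal_wordExpo, h l hl]
    · push Not at hm
      rw [M.coeff_sumVal_eq_zero fun l hl => hm l (List.mem_append_left _ hl),
        M.coeff_sumVal_eq_zero fun l hl => hm l (List.mem_append_right _ hl)]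

theorem sumCoef_primrec : Primrec₂ M.sumCoef := by
  classical
  refine Primrec.list_sum.comp (Primrec.list_map Primrec.fst ?_)
  exact Primrec.ite (M.wordExpo_eq_primrec.comp Primrec.snd (Primrec.snd.comp Primrec.fst))
    (M.wordCoef_primrec.comp Primrec.snd) (Primrec.const 0)

theorem sumVal_eq_primrec : PrimrecRel fun L L' => M.sumVal L = M.sumVal L' := by
  have hrel : PrimrecRel fun (l : List ℕ) (t : List (List ℕ) × List (List ℕ)) =>
      M.sumCoef t.1 l = M.sumCoef t.2 l :=
    Primrec.eq.comp
      (M.sumCoef_primrec.comp (Primrec.fst.comp Primrec.snd) Primrec.fst)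
      (M.sumCoef_primrec.comp (Primrec.snd.comp Primrec.snd) Primrec.fst)
  exact ((hrel.forall_mem_list).comp (Primrec.list_append.comp Primrec.fst Primrec.snd)
    Primrec.id).of_eq fun t => (M.sumVal_eq_iff t.1 t.2).symm

theorem sumVal_append (L L' : List (List ℕ)) :
    M.sumVal (L ++ L') = M.sumVal L + M.sumVal L' := by
  simp [sumVal]

theorem wordVal_append (l l' : List ℕ) : M.wordVal (l ++ l') = M.wordVal l * M.wordVal l' := by
  simp [wordVal]

/-- The formal product of two sums of words. -/
def mulSum (L L' : List (List ℕ)) : List (List ℕ) := L.flatMap fun l => L'.map fun l' => l ++ l'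

theorem sumVal_mulSum (L L' : List (List ℕ)) :
    M.sumVal (mulSum L L') = M.sumVal L * M.sumVal L' := by
  induction L with
  | nil => simp [sumVal, mulSum]
  | cons l L ih =>
    have h1 : M.sumVal (L'.map fun l' => l ++ l') = M.wordVal l * M.sumVal L' := by
      simp only [sumVal, List.map_map, ← List.sum_map_mul_left]
      congr 1
      exact List.map_congr_left fun l' _ => M.wordVal_append l l'
    have h2 : mulSum (l :: L) L' = (L'.map fun l' => l ++ l') ++ mulSum L L' := by simp [mulSum]
    rw [h2, sumVal_append, ih, h1]
    simp [sumVal, add_mul]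

theorem mulSum_primrec : Primrec₂ mulSum := by
  refine Primrec.list_flatMap Primrec.fst (Primrec.list_map (Primrec.snd.comp Primrec.fst) ?_)
  exact Primrec.list_append.comp (Primrec.snd.comp Primrec.fst) Primrec.snd

/-- The ring generated by the terms is computable: an element is coded by two sums of words, of
which it is the difference, and two codes are compared by collecting coefficients. -/
theorem exists_isComputableRing : ∃ (C : Set ℕ) (_ : CommRing C), IsComputableRing C ∧
    Nonempty (C ≃+* Subring.closure (Set.range M.term)) := by
  have word_mem : ∀ l, M.wordVal l ∈ Subring.closure (Set.range M.term) := fun l =>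
    list_prod_mem fun t ht => by
      obtain ⟨g, _, rfl⟩ := List.mem_map.1 ht
      exact Subring.subset_closure ⟨g, rfl⟩
  have sum_mem : ∀ L, M.sumVal L ∈ Subring.closure (Set.range M.term) := fun L =>
    list_sum_mem fun t ht => by
      obtain ⟨l, _, rfl⟩ := List.mem_map.1 ht
      exact word_mem l
  have h11 : Primrec fun t : (List (List ℕ) × List (List ℕ)) × (List (List ℕ) × List (List ℕ)) =>
      t.1.1 := Primrec.fst.comp Primrec.fst
  have h12 : Primrec fun t : (List (List ℕ) × List (List ℕ)) × (List (List ℕ) × List (List ℕ)) =>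
      t.1.2 := Primrec.snd.comp Primrec.fst
  have h21 : Primrec fun t : (List (List ℕ) × List (List ℕ)) × (List (List ℕ) × List (List ℕ)) =>
      t.2.1 := Primrec.fst.comp Primrec.snd
  have h22 : Primrec fun t : (List (List ℕ) × List (List ℕ)) × (List (List ℕ) × List (List ℕ)) =>
      t.2.2 := Primrec.snd.comp Primrec.snd
  refine exists_isComputableRing_of_primrec (α := List (List ℕ) × List (List ℕ))
    (fun c => (⟨M.sumVal c.1 - M.sumVal c.2, sub_mem (sum_mem _) (sum_mem _)⟩ :
      Subring.closure (Set.range M.term))) ?_ ?_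
    (add := fun c d => (c.1 ++ d.1, c.2 ++ d.2))
    (mul := fun c d => (mulSum c.1 d.1 ++ mulSum c.2 d.2, mulSum c.1 d.2 ++ mulSum c.2 d.1))
    ?_ ?_ ?_ ?_
  · rintro ⟨a, ha⟩
    suffices ∃ L L', M.sumVal L - M.sumVal L' = a by
      obtain ⟨L, L', rfl⟩ := this
      exact ⟨(L, L'), rfl⟩
    induction ha using Subring.closure_induction with
    | mem t ht =>
      obtain ⟨g, rfl⟩ := ht
      exact ⟨[[g]], [], by simp [sumVal, wordVal]⟩
    | zero => exact ⟨[], [], by simp⟩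
    | one => exact ⟨[[]], [], by simp [sumVal, wordVal]⟩
    | add a b _ _ iha ihb =>
      obtain ⟨L, L', rfl⟩ := iha
      obtain ⟨K, K', rfl⟩ := ihb
      exact ⟨L ++ K, L' ++ K', by simp only [sumVal_append]; ring⟩
    | neg a _ ih =>
      obtain ⟨L, L', rfl⟩ := ih
      exact ⟨L', L, by ring⟩
    | mul a b _ _ iha ihb =>
      obtain ⟨L, L', rfl⟩ := iha
      obtain ⟨K, K', rfl⟩ := ihb
      exact ⟨mulSum L K ++ mulSum L' K', mulSum L K' ++ mulSum L' K, by
        simp only [sumVal_append, sumVal_mulSum]; ring⟩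
  · refine (M.sumVal_eq_primrec.comp (Primrec.list_append.comp h11 h22)
      (Primrec.list_append.comp h21 h12)).of_eq fun t => ?_
    simp only [sumVal_append]
    rw [Subtype.mk.injEq, sub_eq_sub_iff_add_eq_add]
  · exact (Primrec.list_append.comp h11 h21).pair (Primrec.list_append.comp h12 h22)
  · exact (Primrec.list_append.comp (mulSum_primrec.comp h11 h21)
      (mulSum_primrec.comp h12 h22)).pair
      (Primrec.list_append.comp (mulSum_primrec.comp h11 h22) (mulSum_primrec.comp h12 h21))
  · intro c d
    refine Subtype.ext ?_
    simp only [Subring.coe_add, sumVal_append]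
    ring
  · intro c d
    refine Subtype.ext ?_
    simp only [Subring.coe_mul, sumVal_append, sumVal_mulSum]
    ring

end MonomialFamily

end Words

/-! ### Recursively enumerable conditions -/

section Sigma01

open Nat.Partrec Encodable

/-- Kleene's normal form: a condition `∃ s, D a s` with `D` computable can be written with a
primitive recursive relation, namely that a fixed program searching for `s` halts within a given
bound. -/
theorem ComputablePred.exists_primrecRel {α : Type*} [Primcodable α] {D : α → ℕ → Prop}
    (hD : ComputablePred fun t : α × ℕ => D t.1 t.2) :
    ∃ T : α → ℕ → Prop, PrimrecRel T ∧ ∀ a, (∃ s, D a s) ↔ ∃ s, T a s := by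
  classical
  have hp : Partrec fun a : α => Nat.rfind fun n => Part.some (decide (D a n)) :=
    Partrec.rfind hD.decide.partrec
  obtain ⟨c, hc⟩ := Code.exists_code.1 hp
  refine ⟨fun a s => (Code.evaln s c (encode a)).isSome, ?_, fun a => ?_⟩
  · refine (Primrec.eq.comp (Primrec.option_isSome.comp (Code.primrec_evaln.comp
      ((Primrec.snd.pair (Primrec.const c)).pair (Primrec.encode.comp Primrec.fst))))
      (Primrec.const true)).of_eq fun t => Iff.rfl
  · have h1 : (Code.eval c (encode a)).Dom ↔ ∃ s, D a s := by
      have hdom : (Nat.rfind fun n => Part.some (decide (D a n))).Dom ↔ ∃ s, D a s :=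
        Nat.rfind_dom.trans (by simp)
      rw [hc, ← hdom]
      simp
    rw [← h1, Part.dom_iff_mem]
    simp only [Code.evaln_complete, Option.isSome_iff_exists]
    exact exists_comm

theorem Primrec.nat_prime : PrimrecPred Nat.Prime := by
  have hdvd : PrimrecRel fun m n : ℕ => m ∣ n → m = 1 := by
    refine ((PrimrecPred.not (Primrec.eq.comp (Primrec.nat_mod.comp Primrec.snd Primrec.fst)
      (Primrec.const 0))).or (Primrec.eq.comp Primrec.fst (Primrec.const 1))).of_eq fun t => ?_
    simp only [Nat.dvd_iff_mod_eq_zero]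
    tauto
  refine ((Primrec.nat_le.comp (Primrec.const 2) Primrec.id).and
    ((hdvd.forall_lt).comp Primrec.id Primrec.id)).of_eq fun n => ?_
  rw [Nat.prime_def_lt]
  rfl

theorem Primrec.nat_count {P : ℕ → Prop} [DecidablePred P] (hP : PrimrecPred P) :
    Primrec (Nat.count P) := by
  refine (Primrec.nat_rec₁ 0 (f := fun n c => c + if P n then 1 else 0) ?_).of_eq fun n => ?_
  · exact Primrec.nat_add.comp Primrec.snd
      (Primrec.ite (hP.comp Primrec.fst) (Primrec.const 1) (Primrec.const 0))
  · induction n with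
    | zero => simp
    | succ n ih => rw [Nat.count_succ, ← ih]

theorem ComputablePred.forall_lt {α : Type*} [Primcodable α] {P : α → ℕ → Prop}
    (hP : ComputablePred fun t : α × ℕ => P t.1 t.2) :
    ComputablePred fun t : α × ℕ => ∀ x < t.2, P t.1 x := by
  classical
  have h : Computable fun t : α × ℕ =>
      (Nat.rec true (fun n b => b && decide (P t.1 n)) t.2 : Bool) := by
    refine Computable.nat_rec (h := fun t y => y.2 && decide (P t.1 y.1)) Computable.snd
      (Computable.const true) ?_
    exact Primrec.and.to_comp.comp (Computable.snd.comp Computable.snd)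
      (hP.decide.comp ((Computable.fst.comp Computable.fst).pair
        (Computable.fst.comp Computable.snd)))
  refine (Computable.computablePred (h.of_eq fun t => ?_) :
    ComputablePred fun t : α × ℕ => ∀ x < t.2, P t.1 x)
  rcases t with ⟨a, n⟩
  induction n with
  | zero => simp
  | succ n ih =>
    simp only at ih ⊢
    rw [ih, Bool.eq_iff_iff]
    simp only [Bool.and_eq_true, decide_eq_true_eq, Nat.forall_lt_succ_right]

/-- A `Π⁰₂` set `Q` is described by chains of events: for each prime `q` there is a decreasing
sequence of conditions `V (q, k)` (the first `k` existential conditions for `q` hold), recursively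
enumerable uniformly in `(q, k)`, that all hold if and only if the index of `q` among the primes is
in `Q`. -/
theorem IsPi02.exists_primrecRel {Q : Set ℕ} (hQ : IsPi02 Q) :
    ∃ (V : ℕ × ℕ → Prop) (T : ℕ × ℕ → ℕ → Prop), PrimrecRel T ∧ (∀ a, V a ↔ ∃ s, T a s) ∧
      (∀ q k, V (q, k + 1) → V (q, k)) ∧ (∀ q, V (q, 0) ↔ q.Prime) ∧
      ∀ q, q.Prime → ((∀ k, V (q, k)) ↔ q.count Nat.Prime ∈ Q) := by
  classical
  obtain ⟨R, hR, hRQ⟩ := hQ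
  -- `witness s` is the finite sequence with code `s`, extended by zeros
  let witness : ℕ → ℕ → ℕ := fun s x => ((decode s : Option (List ℕ)).getD []).getD x 0
  have hwitness : Primrec₂ witness := by
    exact (Primrec.list_getD 0).comp
      (Primrec.option_getD.comp (Primrec.decode.comp Primrec.fst) (Primrec.const [])) Primrec.snd
  let D : ℕ × ℕ → ℕ → Prop := fun a s =>
    a.1.Prime ∧ ∀ x < a.2, R x (witness s x) (a.1.count Nat.Prime)
  have hD : ComputablePred fun t : (ℕ × ℕ) × ℕ => D t.1 t.2 := by
    have hR' : ComputablePred fun t : (ℕ × ℕ) × ℕ =>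
        R t.2 (witness t.1.2 t.2) (t.1.1.count Nat.Prime) := by
      refine (Computable.computablePred (hR.decide.comp (Computable.snd.pair (((hwitness.comp
        (Primrec.snd.comp Primrec.fst) Primrec.snd).pair
        ((Primrec.nat_count Primrec.nat_prime).comp (Primrec.fst.comp Primrec.fst))).to_comp))) : _)
    have hforall := ComputablePred.forall_lt (P := fun (t : ℕ × ℕ) x =>
      R x (witness t.2 x) (t.1.count Nat.Prime)) hR'
    refine (Computable.computablePred (Primrec.and.to_comp.comp
      ((Primrec.nat_prime.decide.comp (Primrec.fst.comp Primrec.fst)).to_comp)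
      (hforall.decide.comp (((Primrec.fst.comp Primrec.fst).pair Primrec.snd).pair
        (Primrec.snd.comp Primrec.fst)).to_comp) |>.of_eq fun t => ?_) :
        ComputablePred fun t : (ℕ × ℕ) × ℕ => D t.1 t.2)
    simp [D]
  obtain ⟨T, hT, hTD⟩ := hD.exists_primrecRel
  have hV : ∀ q k, (∃ s, D (q, k) s) ↔
      q.Prime ∧ ∀ x < k, ∃ y, R x y (q.count Nat.Prime) := by
    intro q k
    constructor
    · rintro ⟨s, hq, hs⟩
      exact ⟨hq, fun x hx => ⟨_, hs x hx⟩⟩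
    · rintro ⟨hq, h⟩
      have h' : ∀ x, ∃ y, x < k → R x y (q.count Nat.Prime) := fun x => by
        by_cases hx : x < k
        · exact (h x hx).imp fun y hy _ => hy
        · exact ⟨0, fun h => absurd h hx⟩
      choose y hy using h'
      refine ⟨encode ((List.range k).map y), hq, fun x hx => ?_⟩
      have : witness (encode ((List.range k).map y)) x = y x := by
        simp [witness, List.getD_eq_getElem?_getD, hx]
      exact this ▸ hy x hx
  refine ⟨fun a => ∃ s, D a s, T, hT, hTD, fun q k h => ?_, fun q => ?_, fun q hq => ?_⟩
  · obtain h := (hV _ _).1 h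
    refine (hV _ _).2 ?_
    exact ⟨h.1, fun x hx => h.2 x (hx.trans k.lt_succ_self)⟩
  · exact (hV q 0).trans (by simp)
  · simp only [hV, hRQ, hq, true_and]
    exact ⟨fun h x => h (x + 1) x x.lt_succ_self, fun h _ x _ => h x⟩

end Sigma01

/-! ### The construction -/

section Main

open AddMonoidAlgebra WithZero

/-- Let the variables be the pairs `(q, k)` satisfying the recursively enumerable condition `V`, and
let `ξ` pick out those for which `(q, k + 1)` fails it. Then the ring of common integers is
computable: the generators of `commonIntegers_le` can be enumerated, as being a variable outside the
range of `ξ` is the recursively enumerable condition `V (q, k + 1)`. -/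
theorem exists_isComputableRing_commonIntegers {V : ℕ × ℕ → Prop} {T : ℕ × ℕ → ℕ → Prop}
    (hT : PrimrecRel T) (hV : ∀ a, V a ↔ ∃ s, T a s)
    (hsucc : ∀ q k, V (q, k + 1) → V (q, k)) {ι : Type*} {p : ι → ℕ} [∀ i, Fact (p i).Prime]
    {ξ : ι → {n : ℕ // V n.unpair}} (hp : Function.Injective p)
    (hξ : ∀ i, (ξ i : ℕ).unpair.1 = p i)
    (hrange : ∀ x, x ∈ Set.range ξ ↔ ¬ V ((x : ℕ).unpair.1, (x : ℕ).unpair.2 + 1)) :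
    ∃ (C : Set ℕ) (_ : CommRing C), IsComputableRing C ∧
      Nonempty (C ≃+* commonIntegers (laurentVal p ξ)) := by
  classical
  -- The index `⟨t, s, n⟩` stands for the term of kind `t` (variable, quotient of `q` by the
  -- variable, inverse of the variable) in the variable coded by `n`, if stage `s` shows that this
  -- term belongs to the ring, and for `1` otherwise.
  let var : ℕ → ℕ := fun g => g.unpair.2.unpair.2
  let stage : ℕ → ℕ := fun g => g.unpair.2.unpair.1
  let isVar : ℕ → Prop := fun g => g.unpair.1 = 0 ∧ T (var g).unpair (stage g)
  let isQuot : ℕ → Prop := fun g => g.unpair.1 = 1 ∧ T (var g).unpair (stage g)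
  let isInv : ℕ → Prop := fun g =>
    g.unpair.1 = 2 ∧ T ((var g).unpair.1, (var g).unpair.2 + 1) (stage g)
  have fst_primrec : Primrec fun n : ℕ => n.unpair.1 := Primrec.fst.comp Primrec.unpair
  have snd_primrec : Primrec fun n : ℕ => n.unpair.2 := Primrec.snd.comp Primrec.unpair
  have var_primrec : Primrec var := snd_primrec.comp snd_primrec
  have stage_primrec : Primrec stage := fst_primrec.comp snd_primrec
  have isVar_primrec : PrimrecPred isVar :=
    (Primrec.eq.comp fst_primrec (Primrec.const 0)).and
      (hT.comp (Primrec.unpair.comp var_primrec) stage_primrec)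
  have isQuot_primrec : PrimrecPred isQuot :=
    (Primrec.eq.comp fst_primrec (Primrec.const 1)).and
      (hT.comp (Primrec.unpair.comp var_primrec) stage_primrec)
  have isInv_primrec : PrimrecPred isInv :=
    (Primrec.eq.comp fst_primrec (Primrec.const 2)).and
      (hT.comp ((fst_primrec.comp var_primrec).pair
        (Primrec.succ.comp (snd_primrec.comp var_primrec))) stage_primrec)
  let M : MonomialFamily :=
    { coef := fun g => if isQuot g then (var g).unpair.1 else 1
      var := var
      pos := fun g => if isVar g then 1 else 0
      neg := fun g => if isQuot g ∨ isInv g then 1 else 0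
      coef_primrec := Primrec.ite isQuot_primrec (fst_primrec.comp var_primrec) (Primrec.const 1)
      var_primrec := var_primrec
      pos_primrec := Primrec.ite isVar_primrec (Primrec.const 1) (Primrec.const 0)
      neg_primrec := Primrec.ite (isQuot_primrec.or isInv_primrec) (Primrec.const 1)
        (Primrec.const 0) }
  have term_isVar : ∀ g, isVar g → M.term g = single (Finsupp.single (var g) 1) 1 := fun g hg => by
    have h1 : ¬ isQuot g := fun h => by simpa [hg.1] using h.1
    have h2 : ¬ isInv g := fun h => by simpa [hg.1] using h.1
    simp [MonomialFamily.term, MonomialFamily.expo, M, hg, h1, h2]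
  have term_isQuot : ∀ g, isQuot g → M.term g =
      single (Finsupp.single (var g) (-1)) ((var g).unpair.1 : ℤ) := fun g hg => by
    have h1 : ¬ isVar g := fun h => by simpa [hg.1] using h.1
    simp [MonomialFamily.term, MonomialFamily.expo, M, hg, h1]
  have term_isInv : ∀ g, isInv g → M.term g = single (Finsupp.single (var g) (-1)) 1 :=
    fun g hg => by
      have h1 : ¬ isVar g := fun h => by simpa [hg.1] using h.1
      have h2 : ¬ isQuot g := fun h => by simpa [hg.1] using h.1
      simp [MonomialFamily.term, MonomialFamily.expo, M, hg, h1, h2]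
  have term_eq_one : ∀ g, ¬ isVar g → ¬ isQuot g → ¬ isInv g → M.term g = 1 :=
    fun g h1 h2 h3 => by
      simp [MonomialFamily.term, MonomialFamily.expo, M, h1, h2, h3, one_def]
  let j : MvLaurent {n : ℕ // V n.unpair} →+* MvLaurent ℕ :=
    mapDomainRingHom ℤ (Finsupp.mapDomain.addMonoidHom Subtype.val)
  have j_injective : Function.Injective j :=
    mapDomain_injective (Finsupp.mapDomain_injective Subtype.val_injective)
  have j_single : ∀ x e c, j (single (Finsupp.single x e) c) =
      single (Finsupp.single (x : ℕ) e) c := fun x e c =>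
    mapDomain_single.trans (by simp)
  have hmap : (commonIntegers (laurentVal p ξ)).map j = Subring.closure (Set.range M.term) := by
    apply le_antisymm
    · rw [Subring.map_le_iff_le_comap]
      refine commonIntegers_le hp (fun x => ?_) (fun x hx => ?_) fun i => ?_
      · obtain ⟨s, hs⟩ := (hV _).1 x.2
        refine Subring.subset_closure ⟨Nat.pair 0 (Nat.pair s x), ?_⟩
        rw [j_single, term_isVar _ ⟨by simp, by simpa [var, stage] using hs⟩]
        simp [var]
      · obtain ⟨s, hs⟩ := (hV _).1 (not_not.1 (mt (hrange x).2 hx))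
        refine Subring.subset_closure ⟨Nat.pair 2 (Nat.pair s x), ?_⟩
        rw [j_single, term_isInv _ ⟨by simp, by simpa [var, stage] using hs⟩]
        simp [var]
      · obtain ⟨s, hs⟩ := (hV _).1 (ξ i).2
        refine Subring.subset_closure ⟨Nat.pair 1 (Nat.pair s (ξ i)), ?_⟩
        rw [j_single, term_isQuot _ ⟨by simp, by simpa [var, stage] using hs⟩]
        simp [var, hξ]
    · rw [Subring.closure_le]
      rintro _ ⟨g, rfl⟩
      by_cases h0 : isVar g
      · refine ⟨single (Finsupp.single ⟨var g, (hV _).2 ⟨_, h0.2⟩⟩ 1) 1,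
          single_mem_commonIntegers.2 fun i => ?_, by rw [j_single, term_isVar g h0]⟩
        rw [map_one, one_mul, ← exp_zero, exp_le_exp, Finsupp.single_apply]
        split_ifs <;> simp
      by_cases h1 : isQuot g
      · refine ⟨single (Finsupp.single ⟨var g, (hV _).2 ⟨_, h1.2⟩⟩ (-1)) ((var g).unpair.1 : ℤ),
          single_mem_commonIntegers.2 fun i => ?_, by rw [j_single, term_isQuot g h1]⟩
        rw [Finsupp.single_apply]
        split_ifs with h
        · rw [show (var g).unpair.1 = p i by rw [← hξ, ← h]]
          simp
        · simpa using Int.padicValuation_le_one _ _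
      by_cases h2 : isInv g
      · have hx : V (var g).unpair := hsucc _ _ ((hV _).2 ⟨_, h2.2⟩)
        refine ⟨single (Finsupp.single ⟨var g, hx⟩ (-1)) 1,
          single_mem_commonIntegers.2 fun i => ?_, by rw [j_single, term_isInv g h2]⟩
        rw [Finsupp.single_apply, if_neg fun h =>
          (hrange ⟨var g, hx⟩).1 ⟨i, h.symm⟩ ((hV _).2 ⟨_, h2.2⟩)]
        simp
      · rw [term_eq_one g h0 h1 h2]
        exact one_mem _
  obtain ⟨C, hC, hcomp, ⟨e⟩⟩ := M.exists_isComputableRing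
  exact ⟨C, hC, hcomp, ⟨e.trans ((RingEquiv.subringCongr hmap.symm).trans
    ((commonIntegers (laurentVal p ξ)).equivMapOfInjective j j_injective).symm)⟩⟩

theorem theorem1p5 (Q : Set ℕ) (hQ : IsPi02 Q) :
    ∃ (A : Set ℕ) (_ : CommRing A),
      IsComputableRing A ∧
      IsDomain A ∧ UniqueFactorizationMonoid A ∧
      ∃ ι : ℤ →+* A, Function.Injective ι ∧
        ∀ i : ℕ, Prime (ι ((Nat.nth Nat.Prime i : ℕ) : ℤ)) ↔ i ∈ Q := by
  obtain ⟨V, T, hT, hVT, hsucc, hzero, hVQ⟩ := hQ.exists_primrecRel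
  have hlast : ∀ q : {q : ℕ // q.Prime ∧ ∃ k, ¬ V (q, k)},
      ∃ k, V (q, k) ∧ ¬ V (q, k + 1) := by
    rintro ⟨q, hq, k, hk⟩
    by_contra! hcon
    exact hk (Nat.rec ((hzero q).2 hq) hcon k)
  -- `last q` is the `k` of the last variable `(q, k)`, for the `q` that have finitely many
  choose last hlastV hlast_succ using hlast
  let p : {q : ℕ // q.Prime ∧ ∃ k, ¬ V (q, k)} → ℕ := Subtype.val
  have hpfact : ∀ i, Fact (p i).Prime := fun i => ⟨i.2.1⟩
  let ξ : {q : ℕ // q.Prime ∧ ∃ k, ¬ V (q, k)} → {n : ℕ // V n.unpair} := fun i =>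
    ⟨Nat.pair (p i) (last i), by simpa using hlastV i⟩
  have hξ : ∀ i, (ξ i : ℕ).unpair.1 = p i := fun i => by simp [ξ]
  have hp : Function.Injective p := Subtype.val_injective
  have hξ_inj : Function.Injective ξ := fun i i' h => hp (by rw [← hξ, ← hξ, h])
  have hanti : ∀ q k l, k ≤ l → V (q, l) → V (q, k) := fun q k l hkl =>
    Nat.le_induction id (fun l _ ih h => ih (hsucc q l h)) l hkl
  have hrange : ∀ x, x ∈ Set.range ξ ↔ ¬ V ((x : ℕ).unpair.1, (x : ℕ).unpair.2 + 1) := by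
    intro x
    constructor
    · rintro ⟨i, rfl⟩
      simpa [ξ] using hlast_succ i
    · intro hx
      have hprime : (x : ℕ).unpair.1.Prime := (hzero _).1 (hanti _ _ _ (Nat.zero_le _) x.2)
      let i : {q : ℕ // q.Prime ∧ ∃ k, ¬ V (q, k)} := ⟨(x : ℕ).unpair.1, hprime, _, hx⟩
      refine ⟨i, Subtype.ext ?_⟩
      have hk : last i = (x : ℕ).unpair.2 := by
        apply le_antisymm
        · by_contra! hlt
          exact hx (hanti _ _ _ hlt (hlastV i))
        · by_contra! hlt
          exact hlast_succ i (hanti _ _ _ hlt x.2)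
      change Nat.pair _ _ = _
      rw [hk]
      exact Nat.pair_unpair _
  obtain ⟨C, _, hC, ⟨e⟩⟩ := exists_isComputableRing_commonIntegers hT hVT hsucc hp hξ hrange
  have hufd := (isUniformized_laurentVal p ξ hp hξ_inj).uniqueFactorizationMonoid
  refine ⟨C, inferInstance, hC, e.toMulEquiv.isDomain _,
    e.symm.toMulEquiv.uniqueFactorizationMonoid hufd,
    Int.castRingHom C, fun a b h => ?_, fun i => ?_⟩
  · have := congrArg e h
    simpa using this
  · have hprime := Nat.prime_nth_prime i
    rw [← MulEquiv.prime_iff e.toMulEquiv]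
    have hcast : e.toMulEquiv (Int.castRingHom C ((Nat.nth Nat.Prime i : ℕ) : ℤ)) =
        ((Nat.nth Nat.Prime i : ℕ) : commonIntegers (laurentVal p ξ)) := by
      simp
    have hQi := hVQ _ hprime
    rw [Nat.count_nth_of_infinite Nat.infinite_setOfPred_prime] at hQi
    rw [hcast, ← hQi]
    constructor
    · intro h k
      by_contra hk
      exact not_prime_natCast_commonIntegers hp hξ_inj ⟨_, hprime, k, hk⟩ h
    · intro h
      refine prime_natCast_commonIntegers hprime ?_
      rintro ⟨⟨q, _, k, hk⟩, rfl⟩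
      exact hk (h k)

end Main
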